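/- Fix a countably infinite data domain $\mathbb{D}$ whose only predicate is equality. A trace is an infinite sequence $t\in\mathbb{D}^\omega$. Let $x$ range over a countable set of data variables and $X$ over a countable set of formula (recursion) variables. Constraint expressions are $b ::= \mathsf{true}\mid e=f\mid \neg b\mid b\wedge b$, where $e,f$ are data variables or the placeholder $\star$ for the current data value. The formulae of $\mathrm{cHML}^d$ are $$\varphi ::= \mathsf{tt}\mid \langle b\rangle\varphi\mid \exists x.\varphi\mid \varphi\vee\varphi\mid\varphi\wedge\varphi\mid \min X.\varphi\mid X .$$ A data environment is a partial function $\delta$ with finite domain from data variables to $\mathbb{D}$, and $\rho$ maps each formula variable to a function from data environments to sets of traces. The semantics $[\![\varphi,\rho,\delta]\!]\subseteq\mathbb{D}^\omega$ is given by: $[\![\mathsf{tt},\rho,\delta]\!]=\mathbb{D}^\omega$; $[\![\langle b\rangle\varphi,\rho,\delta]\!]$ is the set of traces $du$ such that $b$ is true under $\delta[\star\mapsto d]$ and $u\in[\![\varphi,\rho,\delta]\!]$; $[\![\exists x.\varphi,\rho,\delta]\!]=\bigcup_{d\in\mathbb{D}}[\![\varphi,\rho,\delta[x\mapsto d]]\!]$;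 $\vee$ and $\wedge$ are union and intersection; $[\![X,\rho,\delta]\!]=\rho(X)(\delta)$; and $[\![\min X.\varphi,\rho,\delta]\!]=F(\delta)$, where $F$ is the least (for pointwise inclusion) function from data environments to sets of traces such that $[\![\varphi,\rho[X\mapsto F],\delta']\!]\subseteq F(\delta')$ for all $\delta'$. As usual, formulae are assumed to be such that every bound occurrence of a recursion variable $X$ lies under a modality $\langle b\rangle$ inside the fixed-point formula binding it, and such that each recursion variable is bound by at most one fixed-point formula. The satisfiability problem for $\mathrm{cHML}^d$ asks, given a closed formula $\varphi$ of $\mathrm{cHML}^d$, whether some trace belongs to $[\![\varphi]\!]$. **Theorem.** The satisfiability problem for $\mathrm{cHML}^d$ is undecidable. More precisely, the halting problem is many-one reducible to it: there is a computable function that maps every pair $(c,n)$ of a program $c$ (a code of a partial recursive function) and an input $n\in\mathbb{N}$ to a closed $\mathrm{cHML}^d$ formula that is satisfiable if and only if $c$ halts on input $n$. Consequently no computable function decides, for all closed $\mathrm{cHML}^d$ formulae, whether they are satisfiable. -/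

import Mathlib

namespace RecHML

/-- Data variables `x, y, …`. -/
abbrev DVar := ℕ

/-- Formula (recursion) variables `X, Y, …`. -/
abbrev FVar := ℕ

/-- Expressions: a data variable, or the placeholder `⋆` for the current action. -/
inductive Exp : Type
  | var (x : DVar)
  | star
  deriving DecidableEq

/-- Boolean constraint expressions. -/
inductive BExp : Type
  | tru
  | eq (e f : Exp)
  | not (b : BExp)
  | and (b c : BExp)
  deriving DecidableEq

/-- Formulae of Hennessy–Milner logic with recursion and data. -/
inductive Formula : Type
  | tt
  | ff
  | pos (b : BExp) (φ : Formula)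
  | nec (b : BExp) (φ : Formula)
  | ex (x : DVar) (φ : Formula)
  | all (x : DVar) (φ : Formula)
  | or (φ ψ : Formula)
  | and (φ ψ : Formula)
  | min (X : FVar) (φ : Formula)
  | max (X : FVar) (φ : Formula)
  | var (X : FVar)
  deriving DecidableEq

/-! ### Effective (bijective) numbering of the formulae -/

namespace Exp

def toNat : Exp → ℕ
  | star => 0
  | var x => x + 1

def ofNat : ℕ → Exp
  | 0 => star
  | x + 1 => var x

theorem ofNat_toNat (e : Exp) : ofNat (toNat e) = e := by
  cases e <;> rfl

theorem toNat_ofNat (n : ℕ) : toNat (ofNat n) = n := by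
  cases n <;> rfl

end Exp

namespace BExp

def toNat : BExp → ℕ
  | tru => 0
  | eq e f => 3 * Nat.pair e.toNat f.toNat + 1
  | not b => 3 * toNat b + 2
  | and b c => 3 * Nat.pair (toNat b) (toNat c) + 3

def ofNat : ℕ → BExp
  | 0 => tru
  | n + 1 =>
    have h1 : (n / 3).unpair.1 < n + 1 :=
      Nat.lt_succ_of_le ((Nat.unpair_left_le _).trans (Nat.div_le_self _ _))
    have h2 : (n / 3).unpair.2 < n + 1 :=
      Nat.lt_succ_of_le ((Nat.unpair_right_le _).trans (Nat.div_le_self _ _))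
    have h3 : n / 3 < n + 1 := Nat.lt_succ_of_le (Nat.div_le_self _ _)
    match n % 3 with
    | 0 => eq (Exp.ofNat (n / 3).unpair.1) (Exp.ofNat (n / 3).unpair.2)
    | 1 => not (ofNat (n / 3))
    | _ => and (ofNat (n / 3).unpair.1) (ofNat (n / 3).unpair.2)

theorem ofNat_toNat (b : BExp) : ofNat (toNat b) = b := by
  induction b with
  | tru => simp [toNat, ofNat]
  | eq e f =>
    have h1 : ∀ k, (3 * k) / 3 = k := by omega
    have h2 : ∀ k, (3 * k) % 3 = 0 := by omega
    simp [toNat, ofNat, h1, h2, Exp.ofNat_toNat]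
  | not b ih =>
    have h1 : ∀ k, (3 * k + 1) / 3 = k := by omega
    have h2 : ∀ k, (3 * k + 1) % 3 = 1 := by omega
    simp [toNat, ofNat, h1, h2, ih]
  | and b c ihb ihc =>
    have h1 : ∀ k, (3 * k + 2) / 3 = k := by omega
    have h2 : ∀ k, (3 * k + 2) % 3 = 2 := by omega
    simp [toNat, ofNat, h1, h2, ihb, ihc]

theorem toNat_ofNat (n : ℕ) : toNat (ofNat n) = n := by
  induction n using Nat.strong_induction_on with
  | _ n ih =>
    cases n with
    | zero => simp [toNat, ofNat]
    | succ n =>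
      have h1 : (n / 3).unpair.1 < n + 1 :=
        Nat.lt_succ_of_le ((Nat.unpair_left_le _).trans (Nat.div_le_self _ _))
      have h2 : (n / 3).unpair.2 < n + 1 :=
        Nat.lt_succ_of_le ((Nat.unpair_right_le _).trans (Nat.div_le_self _ _))
      have h3 : n / 3 < n + 1 := Nat.lt_succ_of_le (Nat.div_le_self _ _)
      have hn : n % 3 = 0 ∨ n % 3 = 1 ∨ n % 3 = 2 := by omega
      rcases hn with h | h | h <;> rw [ofNat] <;>
        simp [h, toNat, Exp.toNat_ofNat, ih _ h1, ih _ h2, ih _ h3] <;> omega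

end BExp

namespace Formula

def toNat : Formula → ℕ
  | tt => 0
  | ff => 1
  | pos b φ => 9 * Nat.pair b.toNat (toNat φ) + 2
  | nec b φ => 9 * Nat.pair b.toNat (toNat φ) + 3
  | ex x φ => 9 * Nat.pair x (toNat φ) + 4
  | all x φ => 9 * Nat.pair x (toNat φ) + 5
  | or φ ψ => 9 * Nat.pair (toNat φ) (toNat ψ) + 6
  | and φ ψ => 9 * Nat.pair (toNat φ) (toNat ψ) + 7
  | min X φ => 9 * Nat.pair X (toNat φ) + 8
  | max X φ => 9 * Nat.pair X (toNat φ) + 9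
  | var X => 9 * X + 10

def ofNat : ℕ → Formula
  | 0 => tt
  | 1 => ff
  | n + 2 =>
    have h1 : (n / 9).unpair.1 < n + 2 :=
      Nat.lt_add_right 1 (Nat.lt_succ_of_le
        ((Nat.unpair_left_le _).trans (Nat.div_le_self _ _)))
    have h2 : (n / 9).unpair.2 < n + 2 :=
      Nat.lt_add_right 1 (Nat.lt_succ_of_le
        ((Nat.unpair_right_le _).trans (Nat.div_le_self _ _)))
    match n % 9 with
    | 0 => pos (BExp.ofNat (n / 9).unpair.1) (ofNat (n / 9).unpair.2)
    | 1 => nec (BExp.ofNat (n / 9).unpair.1) (ofNat (n / 9).unpair.2)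
    | 2 => ex (n / 9).unpair.1 (ofNat (n / 9).unpair.2)
    | 3 => all (n / 9).unpair.1 (ofNat (n / 9).unpair.2)
    | 4 => or (ofNat (n / 9).unpair.1) (ofNat (n / 9).unpair.2)
    | 5 => and (ofNat (n / 9).unpair.1) (ofNat (n / 9).unpair.2)
    | 6 => min (n / 9).unpair.1 (ofNat (n / 9).unpair.2)
    | 7 => max (n / 9).unpair.1 (ofNat (n / 9).unpair.2)
    | _ => var (n / 9)

theorem ofNat_toNat (φ : Formula) : ofNat (toNat φ) = φ := by
  have d : ∀ k r, r < 9 → (9 * k + r) / 9 = k := by omega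
  have m : ∀ k r, r < 9 → (9 * k + r) % 9 = r := by omega
  have d0 : ∀ k, (9 * k) / 9 = k := by omega
  have m0 : ∀ k, (9 * k) % 9 = 0 := by omega
  induction φ with
  | tt => simp [toNat, ofNat]
  | ff => simp [toNat, ofNat]
  | pos b φ ih => simp [toNat, ofNat, d0, m0, BExp.ofNat_toNat, ih]
  | nec b φ ih => simp [toNat, ofNat, d _ 1, m _ 1, BExp.ofNat_toNat, ih]
  | ex x φ ih => simp [toNat, ofNat, d _ 2, m _ 2, ih]
  | all x φ ih => simp [toNat, ofNat, d _ 3, m _ 3, ih]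
  | or φ ψ ih1 ih2 => simp [toNat, ofNat, d _ 4, m _ 4, ih1, ih2]
  | and φ ψ ih1 ih2 => simp [toNat, ofNat, d _ 5, m _ 5, ih1, ih2]
  | min X φ ih => simp [toNat, ofNat, d _ 6, m _ 6, ih]
  | max X φ ih => simp [toNat, ofNat, d _ 7, m _ 7, ih]
  | var X => simp [toNat, ofNat, d _ 8, m _ 8]

theorem toNat_ofNat (n : ℕ) : toNat (ofNat n) = n := by
  induction n using Nat.strong_induction_on with
  | _ n ih =>
    match n with
    | 0 => simp [toNat, ofNat]
    | 1 => simp [toNat, ofNat]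
    | n + 2 =>
      have h1 : (n / 9).unpair.1 < n + 2 :=
        Nat.lt_add_right 1 (Nat.lt_succ_of_le
          ((Nat.unpair_left_le _).trans (Nat.div_le_self _ _)))
      have h2 : (n / 9).unpair.2 < n + 2 :=
        Nat.lt_add_right 1 (Nat.lt_succ_of_le
          ((Nat.unpair_right_le _).trans (Nat.div_le_self _ _)))
      have hn : n % 9 = 0 ∨ n % 9 = 1 ∨ n % 9 = 2 ∨ n % 9 = 3 ∨ n % 9 = 4 ∨ n % 9 = 5 ∨
        n % 9 = 6 ∨ n % 9 = 7 ∨ n % 9 = 8 := by omega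
      rcases hn with h | h | h | h | h | h | h | h | h <;> rw [ofNat] <;>
        simp [h, toNat, BExp.toNat_ofNat, ih _ h1, ih _ h2] <;> omega

/-- The numbering of formulae; computability over `Formula` refers to it. -/
instance : Denumerable Formula :=
  Denumerable.ofEquiv ℕ ⟨toNat, ofNat, ofNat_toNat, toNat_ofNat⟩

/-! ### The fragment, closed formulae, and the conventions on recursion variables -/

/-- The fragment generated by `tt`, `⟨b⟩`, `∃`, `∨`, `∧`, `min` and recursion variables. -/
def IsCHML : Formula → Prop
  | tt => True
  | ff => False
  | pos _ φ => IsCHML φ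
  | nec _ _ => False
  | ex _ φ => IsCHML φ
  | all _ _ => False
  | or φ ψ => IsCHML φ ∧ IsCHML ψ
  | and φ ψ => IsCHML φ ∧ IsCHML ψ
  | min _ φ => IsCHML φ
  | max _ _ => False
  | var _ => True

end Formula

/-- The data variables of an expression. -/
def Exp.dvars : Exp → Set DVar
  | .var x => {x}
  | .star => ∅

/-- The data variables of a constraint expression. -/
def BExp.dvars : BExp → Set DVar
  | .tru => ∅
  | .eq e f => e.dvars ∪ f.dvars
  | .not b => b.dvars
  | .and b c => b.dvars ∪ c.dvars

namespace Formula

/-- The free data variables of a formula. -/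
def freeDVars : Formula → Set DVar
  | tt => ∅
  | ff => ∅
  | pos b φ => b.dvars ∪ freeDVars φ
  | nec b φ => b.dvars ∪ freeDVars φ
  | ex x φ => freeDVars φ \ {x}
  | all x φ => freeDVars φ \ {x}
  | or φ ψ => freeDVars φ ∪ freeDVars ψ
  | and φ ψ => freeDVars φ ∪ freeDVars ψ
  | min _ φ => freeDVars φ
  | max _ φ => freeDVars φ
  | var _ => ∅

/-- The free recursion variables of a formula. -/
def freeFVars : Formula → Set FVar
  | tt => ∅
  | ff => ∅
  | pos _ φ => freeFVars φ
  | nec _ φ => freeFVars φ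
  | ex _ φ => freeFVars φ
  | all _ φ => freeFVars φ
  | or φ ψ => freeFVars φ ∪ freeFVars ψ
  | and φ ψ => freeFVars φ ∪ freeFVars ψ
  | min X φ => freeFVars φ \ {X}
  | max X φ => freeFVars φ \ {X}
  | var X => {X}

/-- A formula is closed when it has neither free data variables nor free recursion variables. -/
def IsClosed (φ : Formula) : Prop :=
  φ.freeDVars = ∅ ∧ φ.freeFVars = ∅

/-- The recursion variables with a free occurrence that is not in the scope of a modality. -/
def unguardedFVars : Formula → Set FVar
  | tt => ∅
  | ff => ∅
  | pos _ _ => ∅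
  | nec _ _ => ∅
  | ex _ φ => unguardedFVars φ
  | all _ φ => unguardedFVars φ
  | or φ ψ => unguardedFVars φ ∪ unguardedFVars ψ
  | and φ ψ => unguardedFVars φ ∪ unguardedFVars ψ
  | min X φ => unguardedFVars φ \ {X}
  | max X φ => unguardedFVars φ \ {X}
  | var X => {X}

/-- The set of subformulae of a formula. -/
def subformulas : Formula → Set Formula
  | tt => {tt}
  | ff => {ff}
  | pos b φ => insert (pos b φ) (subformulas φ)
  | nec b φ => insert (nec b φ) (subformulas φ)
  | ex x φ => insert (ex x φ) (subformulas φ)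
  | all x φ => insert (all x φ) (subformulas φ)
  | or φ ψ => insert (or φ ψ) (subformulas φ ∪ subformulas ψ)
  | and φ ψ => insert (and φ ψ) (subformulas φ ∪ subformulas ψ)
  | min X φ => insert (min X φ) (subformulas φ)
  | max X φ => insert (max X φ) (subformulas φ)
  | var X => {var X}

/-- `φ` is a fixed-point formula that binds the recursion variable `X`. -/
def Binds (X : FVar) (φ : Formula) : Prop :=
  ∃ ψ, φ = min X ψ ∨ φ = max X ψ

/-- Every occurrence of a fixed-point variable is in the scope of a modality inside the
fixed-point formula that binds it. -/
def IsGuarded (φ : Formula) : Prop :=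
  ∀ X ψ, (min X ψ ∈ φ.subformulas ∨ max X ψ ∈ φ.subformulas) → X ∉ ψ.unguardedFVars

/-- Every recursion variable is bound by at most one fixed-point formula. -/
def UniquelyBound (φ : Formula) : Prop :=
  ∀ X, ∀ ψ ∈ φ.subformulas, ∀ χ ∈ φ.subformulas, Binds X ψ → Binds X χ → ψ = χ

/-- The instances of the satisfiability problem: closed formulae of the fragment that obey the
two conventions on recursion variables. -/
def IsInstance (φ : Formula) : Prop :=
  φ.IsCHML ∧ φ.IsClosed ∧ φ.IsGuarded ∧ φ.UniquelyBound

end Formula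

/-! ### Linear-time semantics over a data domain `D` -/

universe u

/-- Infinite traces. -/
abbrev Trace (D : Type u) := ℕ → D

/-- The trace `u` when the given trace is `d u`. -/
def Trace.tail {D : Type u} (t : Trace D) : Trace D := fun n => t (n + 1)

/-- Data environments: partial functions with finite domain from data variables to values. -/
structure DEnv (D : Type u) where
  val : DVar → Option D
  finite_dom : {x | val x ≠ none}.Finite

namespace DEnv

/-- The data environment with empty domain. -/
def empty (D : Type u) : DEnv D := ⟨fun _ => none, by simp⟩

/-- `δ[x ↦ d]`. -/
def update {D : Type u} (δ : DEnv D) (x : DVar) (d : D) : DEnv D where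
  val := Function.update δ.val x (some d)
  finite_dom := by
    refine (δ.finite_dom.insert x).subset fun y hy => ?_
    by_cases h : y = x
    · exact Or.inl h
    · right
      simpa [Function.update_of_ne h] using hy

end DEnv

/-- Data interpretations, ordered pointwise by inclusion. -/
abbrev DInt (D : Type u) := DEnv D → Set (Trace D)

/-- Trace environments. -/
abbrev TEnv (D : Type u) := FVar → DInt D

/-- The value of an expression when the current action is `d` (`none` if undefined). -/
def Exp.eval {D : Type u} (δ : DEnv D) (d : D) : Exp → Option D
  | .var x => δ.val x
  | .star => some d

open Classical in
/-- The truth value of `b` under `δ[⋆ ↦ d]` (`none` if it mentions an undefined variable). -/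
noncomputable def BExp.eval {D : Type u} (δ : DEnv D) (d : D) : BExp → Option Bool
  | .tru => some true
  | .eq e f => Option.map₂ (fun a c => decide (a = c)) (e.eval δ d) (f.eval δ d)
  | .not b => Option.map Bool.not (BExp.eval δ d b)
  | .and b c => Option.map₂ Bool.and (BExp.eval δ d b) (BExp.eval δ d c)

namespace Formula

/-- The denotational semantics. The infimum and supremum are those of the complete lattice
of data interpretations. -/
noncomputable def sem {D : Type u} : Formula → TEnv D → DEnv D → Set (Trace D)
  | tt, _, _ => Set.univ
  | ff, _, _ => ∅
  | pos b φ, ρ, δ => {t | b.eval δ (t 0) = some true ∧ t.tail ∈ sem φ ρ δ}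
  | nec b φ, ρ, δ => {t | b.eval δ (t 0) = some true → t.tail ∈ sem φ ρ δ}
  | ex x φ, ρ, δ => ⋃ d : D, sem φ ρ (δ.update x d)
  | all x φ, ρ, δ => ⋂ d : D, sem φ ρ (δ.update x d)
  | or φ ψ, ρ, δ => sem φ ρ δ ∪ sem ψ ρ δ
  | and φ ψ, ρ, δ => sem φ ρ δ ∩ sem ψ ρ δ
  | min X φ, ρ, δ =>
      (sInf {F : DInt D | (fun δ' => sem φ (Function.update ρ X F) δ') ≤ F}) δ
  | max X φ, ρ, δ =>
      (sSup {F : DInt D | F ≤ (fun δ' => sem φ (Function.update ρ X F) δ')}) δ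
  | var X, ρ, δ => ρ X δ

/-- The set of traces that satisfy a closed formula. For closed formulae the environments are
irrelevant; the empty ones are used. -/
noncomputable def denotation (D : Type u) (φ : Formula) : Set (Trace D) :=
  φ.sem (fun _ _ => ∅) (DEnv.empty D)

/-- Some infinite trace over `D` satisfies the formula. -/
def Satisfiable (D : Type u) (φ : Formula) : Prop :=
  (φ.denotation D).Nonempty

end Formula

end RecHML

/-! A trace whose first `L + 1` letters are distinct is an initial segment of the natural numbers
written backwards: with data variable `0` holding the letter at position `L`, the number `k ≤ L` is
the letter `k` places earlier, and the predecessor of a number is the next letter. That the letters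
are distinct up to the value of `0` is itself expressible (`Formula.distinct`). Least fixed points
then express reachability between pairs of numbers (`Definable.reaches`), hence primitive recursion
and minimisation, so all partial recursive graphs are definable (`GraphDefinable.of_partrec`).

Two obstacles shape the argument. Formulae cannot be negated, so every relation needs a positive
definition; for instance, `f k ≠ 0` is stated as `f k` being a successor. Moreover, each unfolding
of a fixed point consumes a letter, and from position `j` only the numbers up to `L - j` can still
be read. Hence definability is asymmetric: the formula implies the relation from any `j ≤ L`, but
the converse needs a reserve of letters whose size depends on the numbers involved. Satisfiability
asks for some trace, so the reserve may be chosen as large as a given halting computation requires.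

One fixed formula defines the domain of a universal partial recursive function. Program and input
enter only through the numeral of their code, so computability of the reduction is a matter of
building that numeral. -/

namespace RecHML

open Set

universe u

/-! ### Well-formed formulae with controlled variables -/

/-- `φ` lies in the fragment and obeys the conventions on recursion variables, all its recursion
variables are guarded, its free data variables are below `B`, its free recursion variables
belong to `S`, and the recursion variables it binds lie in `[lo, hi)`. -/
structure WF (B : ℕ) (S : Set FVar) (lo hi : ℕ) (φ : Formula) : Prop where
  le : lo ≤ hi
  chml : φ.IsCHML
  dvars : ∀ x ∈ φ.freeDVars, x < B
  fvars : φ.freeFVars ⊆ S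
  unguarded : φ.unguardedFVars = ∅
  guarded : φ.IsGuarded
  unique : φ.UniquelyBound
  bound : ∀ X, ∀ ψ ∈ φ.subformulas, Formula.Binds X ψ → lo ≤ X ∧ X < hi

namespace WF

open Formula

variable {B B' lo mid hi lo' hi' : ℕ} {S S' : Set FVar} {φ ψ : Formula}

theorem mono (h : WF B S lo hi φ) (hB : B ≤ B') (hS : S ⊆ S') (hlo : lo' ≤ lo) (hhi : hi ≤ hi') :
    WF B' S' lo' hi' φ where
  le := hlo.trans (h.le.trans hhi)
  chml := h.chml
  dvars x hx := (h.dvars x hx).trans_le hB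
  fvars := h.fvars.trans hS
  unguarded := h.unguarded
  guarded := h.guarded
  unique := h.unique
  bound X ψ hψ hX := ⟨hlo.trans (h.bound X ψ hψ hX).1, (h.bound X ψ hψ hX).2.trans_le hhi⟩

theorem isInstance (h : WF 0 ∅ lo hi φ) : φ.IsInstance :=
  ⟨h.chml, ⟨eq_empty_of_forall_notMem fun x hx => by simpa using h.dvars x hx,
    subset_empty_iff.1 h.fvars⟩, h.guarded, h.unique⟩

theorem tt : WF B S lo lo Formula.tt where
  le := le_rfl
  chml := trivial
  dvars := by simp [freeDVars]
  fvars := by simp [freeFVars]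
  unguarded := rfl
  guarded := by simp [IsGuarded, subformulas]
  unique := by simp [UniquelyBound, subformulas, Binds]
  bound := by simp [subformulas, Binds]

theorem pos {b : BExp} (hb : ∀ x ∈ b.dvars, x < B) (h : WF B S lo hi φ) :
    WF B S lo hi (Formula.pos b φ) where
  le := h.le
  chml := h.chml
  dvars x hx := hx.elim (hb x) (h.dvars x)
  fvars := h.fvars
  unguarded := rfl
  guarded X χ hχ := h.guarded X χ (by simpa [subformulas] using hχ)
  unique := by
    rintro X χ (rfl | hχ) χ' (rfl | hχ') h1 h2
    · rfl
    · simp [Binds] at h1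
    · simp [Binds] at h2
    · exact h.unique X χ hχ χ' hχ' h1 h2
  bound := by
    rintro X χ (rfl | hχ) h1
    · simp [Binds] at h1
    · exact h.bound X χ hχ h1

/-- A bare recursion variable is never `WF`: variables enter only directly below a modality. This
makes guardedness an invariant of the construction. -/
theorem pos_var {b : BExp} {X : FVar} (hb : ∀ x ∈ b.dvars, x < B) (hX : X ∈ S) :
    WF B S lo lo (Formula.pos b (Formula.var X)) where
  le := le_rfl
  chml := trivial
  dvars x hx := hx.elim (hb x) (by simp [freeDVars])
  fvars := by simpa [freeFVars] using hX
  unguarded := rfl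
  guarded := by simp [IsGuarded, subformulas]
  unique := by simp [UniquelyBound, subformulas, Binds]
  bound := by simp [subformulas, Binds]

theorem ex {x : DVar} (hx : ∀ y ∈ φ.freeDVars, y = x ∨ y < B) (h : WF B' S lo hi φ) :
    WF B S lo hi (Formula.ex x φ) where
  le := h.le
  chml := h.chml
  dvars y hy := (hx y hy.1).resolve_left hy.2
  fvars := h.fvars
  unguarded := h.unguarded
  guarded X χ hχ := h.guarded X χ (by simpa [subformulas] using hχ)
  unique := by
    rintro X χ (rfl | hχ) χ' (rfl | hχ') h1 h2
    · rfl
    · simp [Binds] at h1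
    · simp [Binds] at h2
    · exact h.unique X χ hχ χ' hχ' h1 h2
  bound := by
    rintro X χ (rfl | hχ) h1
    · simp [Binds] at h1
    · exact h.bound X χ hχ h1

theorem ex_last (h : WF (B + 1) S lo hi φ) : WF B S lo hi (Formula.ex B φ) :=
  ex (fun y hy => (Nat.lt_succ_iff_lt_or_eq.1 (h.dvars y hy)).symm) h

theorem ex_same_bound {x : DVar} (h : WF B S lo hi φ) : WF B S lo hi (Formula.ex x φ) :=
  ex (fun y hy => Or.inr (h.dvars y hy)) h

/-- The bound recursion variables of the two halves lie in adjacent disjoint intervals, so none is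
bound on both sides. -/
theorem and (h : WF B S lo mid φ) (h' : WF B S mid hi ψ) :
    WF B S lo hi (Formula.and φ ψ) where
  le := h.le.trans h'.le
  chml := ⟨h.chml, h'.chml⟩
  dvars x hx := hx.elim (h.dvars x) (h'.dvars x)
  fvars := union_subset h.fvars h'.fvars
  unguarded := by simp [unguardedFVars, h.unguarded, h'.unguarded]
  guarded X χ hχ := by
    have := h.guarded X χ
    have := h'.guarded X χ
    simp only [subformulas, mem_insert_iff, mem_union, reduceCtorEq, false_or] at hχ
    tauto
  unique := by
    rintro X χ (rfl | hχ | hχ) χ' (rfl | hχ' | hχ') h1 h2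
    any_goals first | (simp [Binds] at h1; done) | (simp [Binds] at h2; done)
    · exact h.unique X χ hχ χ' hχ' h1 h2
    · exact absurd ((h.bound X χ hχ h1).2.trans_le (h'.bound X χ' hχ' h2).1) (lt_irrefl _)
    · exact absurd ((h.bound X χ' hχ' h2).2.trans_le (h'.bound X χ hχ h1).1) (lt_irrefl _)
    · exact h'.unique X χ hχ χ' hχ' h1 h2
  bound := by
    rintro X χ (rfl | hχ | hχ) h1
    · simp [Binds] at h1
    · exact ⟨(h.bound X χ hχ h1).1, (h.bound X χ hχ h1).2.trans_le h'.le⟩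
    · exact ⟨h.le.trans (h'.bound X χ hχ h1).1, (h'.bound X χ hχ h1).2⟩

theorem or (h : WF B S lo mid φ) (h' : WF B S mid hi ψ) :
    WF B S lo hi (Formula.or φ ψ) where
  le := h.le.trans h'.le
  chml := ⟨h.chml, h'.chml⟩
  dvars x hx := hx.elim (h.dvars x) (h'.dvars x)
  fvars := union_subset h.fvars h'.fvars
  unguarded := by simp [unguardedFVars, h.unguarded, h'.unguarded]
  guarded X χ hχ := (h.and h').guarded X χ (by simpa [subformulas] using hχ)
  unique := by
    rintro X χ (rfl | hχ) χ' (rfl | hχ') h1 h2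
    any_goals first | (simp [Binds] at h1; done) | (simp [Binds] at h2; done)
    · exact (h.and h').unique X χ (.inr hχ) χ' (.inr hχ') h1 h2
  bound := by
    rintro X χ (rfl | hχ) h1
    · simp [Binds] at h1
    · exact (h.and h').bound X χ (.inr hχ) h1

theorem min (h : WF B (insert lo S) (lo + 1) hi φ) : WF B S lo hi (Formula.min lo φ) where
  le := (Nat.le_succ _).trans h.le
  chml := h.chml
  dvars := h.dvars
  fvars X hX := (h.fvars hX.1).resolve_left hX.2
  unguarded := by simp [unguardedFVars, h.unguarded]
  guarded X χ hχ := by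
    simp only [subformulas, mem_insert_iff, Formula.min.injEq, reduceCtorEq, false_or] at hχ
    rcases hχ with (⟨rfl, rfl⟩ | hχ) | hχ
    · simp [h.unguarded]
    · exact h.guarded X χ (.inl hχ)
    · exact h.guarded X χ (.inr hχ)
  unique := by
    have key : ∀ X, ∀ χ ∈ φ.subformulas, Binds X χ → ¬ Binds X (Formula.min lo φ) := by
      rintro X χ hχ h1 ⟨_, h2 | h2⟩
      · cases h2
        have := h.bound _ χ hχ h1
        omega
      · cases h2
    rintro X χ (rfl | hχ) χ' (rfl | hχ') h1 h2
    · rfl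
    · exact absurd h1 (key X χ' hχ' h2)
    · exact absurd h2 (key X χ hχ h1)
    · exact h.unique X χ hχ χ' hχ' h1 h2
  bound := by
    rintro X χ (rfl | hχ) h1
    · obtain ⟨_, h2 | h2⟩ := h1
      · cases h2
        exact ⟨le_rfl, h.le⟩
      · cases h2
    · exact ⟨Nat.le_of_succ_le (h.bound X χ hχ h1).1, (h.bound X χ hχ h1).2⟩

end WF

/-! ### Evaluation of constraints and of fixed points -/

section Semantics

variable {D : Type u}

/-- The suffix of a trace from position `j` on. -/
def Trace.drop (j : ℕ) (t : Trace D) : Trace D := fun i => t (j + i)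

theorem Trace.drop_zero (t : Trace D) : t.drop 0 = t := by
  funext i; simp [drop]

theorem Trace.drop_apply_zero (j : ℕ) (t : Trace D) : t.drop j 0 = t j := rfl

theorem Trace.tail_drop (j : ℕ) (t : Trace D) : (t.drop j).tail = t.drop (j + 1) := by
  funext i; simp only [tail, drop]; congr 1; omega

/-- The constraint `e ≠ f`. -/
abbrev BExp.ne (e f : Exp) : BExp := .not (.eq e f)

theorem BExp.eval_and {δ : DEnv D} {d : D} {b c : BExp} :
    (b.and c).eval δ d = some true ↔ b.eval δ d = some true ∧ c.eval δ d = some true := by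
  simp [BExp.eval, Option.map₂_eq_some_iff]

theorem BExp.eval_eq {δ : DEnv D} {d : D} {e f : Exp} :
    (BExp.eq e f).eval δ d = some true ↔ ∃ a, e.eval δ d = some a ∧ f.eval δ d = some a := by
  simp [BExp.eval, Option.map₂_eq_some_iff]

theorem BExp.eval_ne {δ : DEnv D} {d : D} {e f : Exp} :
    (BExp.ne e f).eval δ d = some true ↔
      ∃ a c, e.eval δ d = some a ∧ f.eval δ d = some c ∧ a ≠ c := by
  simp [BExp.eval, Option.map₂_eq_some_iff]

/-- Choosing `F` to be a semantic property gives fixed-point induction, used for soundness; keeping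
`F` arbitrary and unfolding through the hypothesis on `F` gives completeness. -/
theorem Formula.mem_sem_min {X : FVar} {φ : Formula} {ρ : TEnv D} {δ : DEnv D} {s : Trace D} :
    s ∈ (Formula.min X φ).sem ρ δ ↔
      ∀ F : DInt D, (∀ δ', φ.sem (Function.update ρ X F) δ' ⊆ F δ') → s ∈ F δ := by
  simp only [Formula.sem, sInf_apply, iInf_eq_iInter, mem_iInter, Subtype.forall, mem_ofPred_eq]
  rfl

theorem DEnv.update_same (δ : DEnv D) (x : DVar) (d : D) : (δ.update x d).val x = some d := by
  simp [update]

theorem DEnv.update_of_ne (δ : DEnv D) {x y : DVar} (h : y ≠ x) (d : D) :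
    (δ.update x d).val y = δ.val y := by
  simp [update, h]

/-- The formula "`φ` holds at some later position, before or at the next occurrence of the value
of the data variable `0`". -/
def Formula.eventually (X : FVar) (φ : Formula) : Formula :=
  .min X (.or φ (.pos (.ne .star (.var 0)) (.var X)))

theorem WF.eventually {B lo hi : ℕ} {S : Set FVar} {φ : Formula} (hB : 0 < B)
    (h : WF B S (lo + 1) hi φ) : WF B S lo hi (φ.eventually lo) :=
  WF.min <| (h.mono le_rfl (subset_insert _ _) le_rfl le_rfl).or <|
    WF.pos_var (by simpa [BExp.dvars, Exp.dvars] using hB) (mem_insert _ _)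

/-- The guard fails at position `L`, whose letter is the value of `0`, and at no earlier position by
injectivity; so the search covers exactly the positions from `j` to `L`. -/
theorem Formula.mem_sem_eventually {X : FVar} {φ : Formula} {t : Trace D} {L j : ℕ}
    (ht : InjOn t (Iic L)) (hj : j ≤ L) {ρ : TEnv D} {δ : DEnv D} (hδ : δ.val 0 = some (t L))
    {P : Trace D → Prop} (hP : ∀ ρ s, s ∈ φ.sem ρ δ ↔ P s) :
    t.drop j ∈ (φ.eventually X).sem ρ δ ↔ ∃ i, j ≤ i ∧ i ≤ L ∧ P (t.drop i) := by
  rw [Formula.eventually, Formula.mem_sem_min]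
  constructor
  · intro h
    -- The invariant is restricted to `δ' = δ` because `hP` describes `φ` in that data environment
    -- only; the recursion does not change it.
    refine h (fun δ' => {s | δ' = δ → ∀ j ≤ L, s = t.drop j →
      ∃ i, j ≤ i ∧ i ≤ L ∧ P (t.drop i)}) ?_ rfl j hj rfl
    rintro δ' s hs rfl j hj rfl
    rcases hs with hs | ⟨hs, hs'⟩
    · exact ⟨j, le_rfl, hj, (hP _ _).1 hs⟩
    · rw [BExp.eval_ne] at hs
      obtain ⟨a, c, ha, hc, hac⟩ := hs
      simp only [Exp.eval, hδ, Option.some.injEq, Trace.drop_apply_zero] at ha hc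
      have hjL : j ≠ L := by rintro rfl; exact hac (ha.symm.trans hc)
      rw [Trace.tail_drop] at hs'
      simp only [Formula.sem, Function.update_self, mem_ofPred_eq] at hs'
      obtain ⟨i, h1, h2, h3⟩ := hs' trivial (j + 1) (by omega) rfl
      exact ⟨i, by omega, h2, h3⟩
  · rintro ⟨i, hji, hiL, hi⟩ F hF
    induction hji using Nat.decreasingInduction with
    | self => exact hF δ (Or.inl ((hP _ _).2 hi))
    | of_succ k hk ih =>
      refine hF δ (Or.inr ⟨?_, ?_⟩)
      · rw [BExp.eval_ne]
        refine ⟨t k, t L, rfl, hδ, fun h => ?_⟩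
        have := ht (show k ∈ Iic L from hj) (show L ∈ Iic L from le_refl L) h
        omega
      · rw [Trace.tail_drop]
        simpa [Formula.sem] using ih (by omega)

end Semantics

/-! ### Definable relations between numbers

A trace whose first `L + 1` letters are distinct represents the number `k ≤ L` by its letter at
position `L - k`. -/

/-- The data variables below `B` represent the numbers given by `v`, and `0` represents zero. -/
def Represents {D : Type u} (t : Trace D) (L B : ℕ) (δ : DEnv D) (v : ℕ → ℕ) : Prop :=
  v 0 = 0 ∧ ∀ x < B, v x ≤ L ∧ δ.val x = some (t (L - v x))

namespace Represents

variable {D : Type u} {t : Trace D} {L B : ℕ} {δ : DEnv D} {v : ℕ → ℕ}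

theorem zero (h : Represents t L B δ v) (hB : 0 < B) : δ.val 0 = some (t L) := by
  simpa [h.1] using (h.2 0 hB).2

theorem mono {B' : ℕ} (h : Represents t L B δ v) (hB : B' ≤ B) : Represents t L B' δ v :=
  ⟨h.1, fun x hx => h.2 x (hx.trans_le hB)⟩

theorem update (h : Represents t L B δ v) (hB : 0 < B) {k : ℕ} (hk : k ≤ L) :
    Represents t L (B + 1) (δ.update B (t (L - k))) (Function.update v B k) := by
  refine ⟨by simp [Function.update_of_ne hB.ne, h.1], fun x hx => ?_⟩
  rcases (Nat.lt_succ_iff_lt_or_eq.1 hx) with hx | rfl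
  · rw [Function.update_of_ne hx.ne, DEnv.update_of_ne _ hx.ne]
    exact h.2 x hx
  · simp [hk, DEnv.update_same]

theorem update_of_le (h : Represents t L B δ v) {y : ℕ} (hy : B ≤ y) (d : D) :
    Represents t L B (δ.update y d) v :=
  ⟨h.1, fun x hx => by
    rw [DEnv.update_of_ne _ (hx.trans_le hy).ne]
    exact h.2 x hx⟩

theorem update_two (h : Represents t L B δ v) (hB : 0 < B) {a b : ℕ} (ha : a ≤ L) (hb : b ≤ L) :
    Represents t L (B + 2) ((δ.update B (t (L - a))).update (B + 1) (t (L - b)))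
      (Function.update (Function.update v B a) (B + 1) b) :=
  (h.update hB ha).update (Nat.succ_pos B) hb

end Represents

/-- On every suffix that starts at a position `j ≤ L`, the formula implies the relation. -/
def Sound (D : Type u) (B : ℕ) (φ : Formula) (R : (ℕ → ℕ) → Prop) : Prop :=
  ∀ (t : Trace D) (L : ℕ), InjOn t (Iic L) → ∀ j ≤ L, ∀ (ρ : TEnv D) (δ : DEnv D) (v : ℕ → ℕ),
    Represents t L B δ v → t.drop j ∈ φ.sem ρ δ → R v

/-- If the relation holds, so does the formula, provided that the suffix is long enough. -/
def Complete (D : Type u) (B : ℕ) (φ : Formula) (R : (ℕ → ℕ) → Prop) : Prop :=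
  ∀ v : ℕ → ℕ, R v → ∃ N, ∀ (t : Trace D) (L : ℕ), InjOn t (Iic L) → ∀ j, j + N ≤ L →
    ∀ (ρ : TEnv D) (δ : DEnv D), Represents t L B δ v → t.drop j ∈ φ.sem ρ δ

/-- The relation `R` between the numbers `v 0 = 0, v 1, …, v (B - 1)` is defined by a closed
formula that binds fresh recursion variables. -/
def Definable (D : Type u) (B : ℕ) (R : (ℕ → ℕ) → Prop) : Prop :=
  ∀ lo, ∃ hi φ, WF B ∅ lo hi φ ∧ Sound D B φ R ∧ Complete D B φ R

/-- The formula "`x` represents a number". -/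
def Formula.num (X : FVar) (x : DVar) : Formula :=
  (Formula.pos (.eq .star (.var x)) .tt).eventually X

theorem WF.num {B lo x : ℕ} (hx : x < B) : WF B ∅ lo (lo + 1) (Formula.num lo x) :=
  (WF.tt.pos (by simpa [BExp.dvars, Exp.dvars] using hx)).eventually (Nat.zero_lt_of_lt hx)

/-- The bound `j ≤ i` means that only numbers up to `L - j` are recognised from position `j`. This
is one source of the reserve in `Complete`. -/
theorem Formula.mem_sem_num {D : Type u} {X : FVar} {x : DVar} {t : Trace D} {L j : ℕ}
    (ht : InjOn t (Iic L)) (hj : j ≤ L) {ρ : TEnv D} {δ : DEnv D} (hδ : δ.val 0 = some (t L)) :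
    t.drop j ∈ (Formula.num X x).sem ρ δ ↔ ∃ i, j ≤ i ∧ i ≤ L ∧ δ.val x = some (t i) := by
  rw [Formula.num, Formula.mem_sem_eventually ht hj hδ
    (P := fun s => δ.val x = some (s 0))]
  · rfl
  · intro ρ s
    simp [Formula.sem, BExp.eval_eq, Exp.eval]

theorem Formula.mem_sem_num_of_represents {D : Type u} {X : FVar} {x : DVar} {t : Trace D}
    {L j B : ℕ} (ht : InjOn t (Iic L)) {ρ : TEnv D} {δ : DEnv D} {v : ℕ → ℕ}
    (h : Represents t L B δ v) (hx : x < B) (hj : j + v x ≤ L) :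
    t.drop j ∈ (Formula.num X x).sem ρ δ :=
  (Formula.mem_sem_num ht (by omega) (h.zero (Nat.zero_lt_of_lt hx))).2
    ⟨L - v x, by omega, by omega, (h.2 x hx).2⟩

/-! ### Closure properties of definable relations. -/

namespace Definable

variable {D : Type u} {B : ℕ} {R R' : (ℕ → ℕ) → Prop}

theorem congr (h : Definable D B R) (hR : ∀ v, v 0 = 0 → (R' v ↔ R v)) : Definable D B R' := by
  intro lo
  obtain ⟨hi, φ, hw, hs, hc⟩ := h lo
  refine ⟨hi, φ, hw, fun t L ht j hj ρ δ v hv h => (hR v hv.1).2 (hs t L ht j hj ρ δ v hv h),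
    fun v hv => ?_⟩
  by_cases h0 : v 0 = 0
  · exact hc v ((hR v h0).1 hv)
  -- `Represents` forces `v 0 = 0`, so completeness is vacuous for other valuations.
  · exact ⟨0, fun t L ht j hj ρ δ hr => absurd hr.1 h0⟩

theorem true : Definable D B fun _ => True := fun lo =>
  ⟨lo, .tt, WF.tt, fun _ _ _ _ _ _ _ _ _ _ => trivial, fun _ _ =>
    ⟨0, fun _ _ _ _ _ _ _ _ => trivial⟩⟩

theorem eq {x y : ℕ} (hx : x < B) (hy : y < B) : Definable D B fun v => v x = v y := by
  intro lo
  refine ⟨lo, .pos (.eq (.var x) (.var y)) .tt, WF.tt.pos ?_, ?_, ?_⟩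
  · rintro z (rfl | rfl)
    exacts [hx, hy]
  · rintro t L ht j hj ρ δ v hv ⟨h, -⟩
    obtain ⟨a, h1, h2⟩ := BExp.eval_eq.1 h
    simp only [Exp.eval, (hv.2 x hx).2, (hv.2 y hy).2, Option.some.injEq] at h1 h2
    have := ht (mem_Iic.2 (Nat.sub_le _ _)) (mem_Iic.2 (Nat.sub_le _ _)) (h1.trans h2.symm)
    have := (hv.2 x hx).1
    have := (hv.2 y hy).1
    omega
  · refine fun v hR => ⟨0, fun t L ht j hj ρ δ hv => ⟨BExp.eval_eq.2 ⟨t (L - v x), ?_, ?_⟩,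
      trivial⟩⟩
    · exact (hv.2 x hx).2
    · rw [hR]; exact (hv.2 y hy).2

/-- The letter after that of `k + 1` is that of `k`. The test against `0` excludes position `L`,
whose next letter lies outside the injective prefix and could be anything. -/
theorem succ {x y : ℕ} (hx : x < B) (hy : y < B) : Definable D B fun v => v x = v y + 1 := by
  intro lo
  have hP : ∀ (δ : DEnv D) (ρ : TEnv D) (s : Trace D),
      s ∈ (Formula.pos (.and (.eq .star (.var x)) (.ne .star (.var 0)))
        (.pos (.eq .star (.var y)) .tt)).sem ρ δ ↔
        (δ.val x = some (s 0) ∧ ∃ c, δ.val 0 = some c ∧ s 0 ≠ c) ∧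
          δ.val y = some (s 1) := by
    intro δ ρ s
    simp [Formula.sem, BExp.eval_eq, BExp.eval_and, BExp.eval_ne, Exp.eval, Trace.tail]
  refine ⟨lo + 1, (Formula.pos (.and (.eq .star (.var x)) (.ne .star (.var 0)))
    (.pos (.eq .star (.var y)) .tt)).eventually lo,
    WF.eventually (Nat.zero_lt_of_lt hx) ((WF.tt.pos ?_).pos ?_), ?_, ?_⟩
  · simpa [BExp.dvars, Exp.dvars] using hy
  · simpa [BExp.dvars, Exp.dvars] using ⟨Nat.zero_lt_of_lt hx, hx⟩
  · intro t L ht j hj ρ δ v hv h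
    have h0 := hv.zero (Nat.zero_lt_of_lt hx)
    rw [Formula.mem_sem_eventually ht hj h0 (hP δ)] at h
    obtain ⟨i, hji, hiL, ⟨h1, c, hc, h2⟩, h3⟩ := h
    simp only [(hv.2 x hx).2, (hv.2 y hy).2, h0, Option.some.injEq] at h1 h3 hc
    change t (L - v x) = t i at h1
    change t (L - v y) = t (i + 1) at h3
    have hi : i ≠ L := by rintro rfl; exact h2 hc
    have e1 := ht (mem_Iic.2 (Nat.sub_le _ _)) (mem_Iic.2 hiL) h1
    have e2 := ht (mem_Iic.2 (Nat.sub_le _ _)) (mem_Iic.2 (by omega)) h3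
    have := (hv.2 x hx).1
    have := (hv.2 y hy).1
    omega
  · refine fun v hR => ⟨v x, fun t L ht j hj ρ δ hv => ?_⟩
    have h0 := hv.zero (Nat.zero_lt_of_lt hx)
    rw [Formula.mem_sem_eventually ht (by omega) h0 (hP δ)]
    refine ⟨L - v x, by omega, by omega, ⟨(hv.2 x hx).2, t L, h0, fun h => ?_⟩, ?_⟩
    · have := ht (mem_Iic.2 (Nat.sub_le _ _)) (mem_Iic.2 le_rfl) h
      omega
    · rw [(hv.2 y hy).2]
      change some (t (L - v y)) = some (t (L - v x + 1))
      congr 2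
      omega

theorem and (h : Definable D B R) (h' : Definable D B R') :
    Definable D B fun v => R v ∧ R' v := by
  intro lo
  obtain ⟨mid, φ, hw, hs, hc⟩ := h lo
  obtain ⟨hi, ψ, hw', hs', hc'⟩ := h' mid
  refine ⟨hi, .and φ ψ, hw.and hw', fun t L ht j hj ρ δ v hv h =>
    ⟨hs t L ht j hj ρ δ v hv h.1, hs' t L ht j hj ρ δ v hv h.2⟩, fun v hv => ?_⟩
  obtain ⟨N, hN⟩ := hc v hv.1
  obtain ⟨N', hN'⟩ := hc' v hv.2
  exact ⟨N + N', fun t L ht j hj ρ δ hr =>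
    ⟨hN t L ht j (by omega) ρ δ hr, hN' t L ht j (by omega) ρ δ hr⟩⟩

theorem ex (hB : 0 < B) (h : Definable D (B + 1) R) :
    Definable D B fun v => ∃ k, R (Function.update v B k) := by
  intro lo
  obtain ⟨hi, φ, hw, hs, hc⟩ := h (lo + 1)
  refine ⟨hi, .ex B (.and (.num lo B) φ), ((WF.num (Nat.lt_succ_self B)).and hw).ex_last, ?_, ?_⟩
  · intro t L ht j hj ρ δ v hv h
    obtain ⟨d, h1, h2⟩ := mem_iUnion.1 h
    rw [Formula.mem_sem_num ht hj (by rw [DEnv.update_of_ne _ hB.ne, hv.zero hB])] at h1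
    obtain ⟨i, -, hiL, hi⟩ := h1
    rw [DEnv.update_same, Option.some.injEq] at hi
    have hd : d = t (L - (L - i)) := by rw [hi, Nat.sub_sub_self hiL]
    subst hd
    exact ⟨L - i, hs t L ht j hj ρ _ _ (hv.update hB (Nat.sub_le _ _)) h2⟩
  · rintro v ⟨k, hk⟩
    obtain ⟨N, hN⟩ := hc _ hk
    refine ⟨N + k, fun t L ht j hj ρ δ hr => mem_iUnion.2 ⟨t (L - k), ?_, ?_⟩⟩
    · refine Formula.mem_sem_num_of_represents ht (hr.update hB (by omega)) (Nat.lt_succ_self B) ?_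
      rw [Function.update_self]
      omega
    · exact hN t L ht j (by omega) ρ _ (hr.update hB (by omega))

theorem forall_fin (n : ℕ) {R : Fin n → (ℕ → ℕ) → Prop} (h : ∀ i, Definable D B (R i)) :
    Definable D B fun v => ∀ i, R i v := by
  induction n with
  | zero => exact true.congr fun v _ => by simp
  | succ n ih =>
    exact ((h 0).and (ih fun i => h i.succ)).congr fun v _ => by simp [Fin.forall_fin_succ]

/-- Quantifies a block of `n` fresh variables at once. Ranging over whole valuations `w` is
harmless, since formulae for `R` are tested only against values below `B + n`. -/
theorem exists_agree (hB : 0 < B) (n : ℕ) {R : (ℕ → ℕ) → Prop} (h : Definable D (B + n) R) :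
    Definable D B fun v => ∃ w : ℕ → ℕ, (∀ x < B, w x = v x) ∧ R w := by
  induction n generalizing R with
  | zero =>
    intro lo
    obtain ⟨hi, φ, hw, hs, hc⟩ := h lo
    refine ⟨hi, φ, hw, fun t L ht j hj ρ δ v hv h =>
      ⟨v, fun _ _ => rfl, hs t L ht j hj ρ δ v hv h⟩, ?_⟩
    rintro v ⟨w, hwv, hR⟩
    obtain ⟨N, hN⟩ := hc w hR
    refine ⟨N, fun t L ht j hj ρ δ hr => hN t L ht j hj ρ δ ⟨?_, fun x hx => ?_⟩⟩
    · rw [hwv 0 hB, hr.1]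
    · rw [hwv x hx]; exact hr.2 x hx
  | succ n ih =>
    refine (ih (h.ex (Nat.add_pos_left hB n))).congr fun v _ => ⟨?_, ?_⟩
    · rintro ⟨w, hwv, hR⟩
      exact ⟨w, hwv, w (B + n), by rwa [Function.update_eq_self]⟩
    · rintro ⟨w, hwv, k, hR⟩
      exact ⟨_, fun x hx => by rw [Function.update_of_ne (by omega), hwv x hx], hR⟩

end Definable

/-! ### Reachability as a least fixed point. -/

/-- The least relation that contains `R` and is closed under going back along a step `T` from the
numbers `v B`, `v (B + 1)` to the numbers `v (B + 2)`, `v (B + 3)`. -/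
inductive Reaches (B : ℕ) (R T : (ℕ → ℕ) → Prop) : (ℕ → ℕ) → Prop
  | base {v} (h : R v) : Reaches B R T v
  | step {v} (a b : ℕ) (h : T (Function.update (Function.update v (B + 2) a) (B + 3) b))
      (h' : Reaches B R T (Function.update (Function.update v B a) (B + 1) b)) : Reaches B R T v

/-- The formula that defines `Reaches`, given formulae for the two relations. -/
def Formula.reaches (lo mid mid' B : ℕ) (φ ψ : Formula) : Formula :=
  .min lo (.or φ (.ex (B + 2) (.ex (B + 3) (.and (.num mid (B + 2)) (.and (.num mid' (B + 3))
    (.and ψ (.ex B (.ex (B + 1) (.pos (.and (.and (.eq (.var B) (.var (B + 2)))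
      (.eq (.var (B + 1)) (.var (B + 3)))) (.ne .star (.var 0))) (.var lo))))))))))

variable {D : Type u} {B : ℕ} {R T : (ℕ → ℕ) → Prop}

theorem WF.reaches {lo mid hi : ℕ} {φ ψ : Formula} (hφ : WF (B + 2) ∅ (lo + 1) mid φ)
    (hψ : WF (B + 4) ∅ (mid + 2) hi ψ) :
    WF (B + 2) ∅ lo hi (Formula.reaches lo mid (mid + 1) B φ ψ) := by
  have hS : (∅ : Set FVar) ⊆ insert lo ∅ := empty_subset _
  refine WF.min (WF.or (hφ.mono le_rfl hS le_rfl le_rfl) (WF.ex_last (WF.ex_last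
    (((WF.num (by omega)).mono le_rfl hS le_rfl le_rfl).and
      (((WF.num (by omega)).mono le_rfl hS le_rfl le_rfl).and
        ((hψ.mono le_rfl hS le_rfl le_rfl).and (WF.ex_same_bound (WF.ex_same_bound
          (WF.pos_var ?_ (mem_insert _ _))))))))))
  intro x hx
  simp only [BExp.dvars, Exp.dvars, mem_union, mem_singleton_iff, mem_empty_iff_false,
    false_or] at hx
  rcases hx with ((rfl | rfl) | rfl | rfl) | rfl
  exacts [Nat.lt_add_of_pos_right (by omega), Nat.lt_succ_self _ |>.trans (by omega),
    Nat.lt_succ_self _ |>.trans (by omega), Nat.lt_succ_self _, Nat.succ_pos _]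

theorem Sound.reaches {lo mid mid' : ℕ} {φ ψ : Formula} (hB : 0 < B)
    (hφ : Sound D (B + 2) φ R) (hψ : Sound D (B + 4) ψ T) :
    Sound D (B + 2) (Formula.reaches lo mid mid' B φ ψ) (Reaches B R T) := by
  intro t L ht j hj ρ δ v hv h
  rw [Formula.reaches, Formula.mem_sem_min] at h
  -- Here the invariant must range over all data environments, positions and valuations, since each
  -- unfolding rebinds `B` and `B + 1` and moves on by one letter.
  refine h (fun δ => {s | ∀ j ≤ L, s = t.drop j → ∀ v, Represents t L (B + 2) δ v →
    Reaches B R T v}) ?_ j hj rfl v hv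
  rintro δ s hs j hj rfl v hv
  rcases hs with hs | hs
  · exact .base (hφ t L ht j hj _ δ v hv hs)
  obtain ⟨d, hs⟩ := mem_iUnion.1 hs
  obtain ⟨e, h1, h2, h3, hs⟩ := mem_iUnion.1 hs
  obtain ⟨d', hs⟩ := mem_iUnion.1 hs
  obtain ⟨e', hs, hs'⟩ := mem_iUnion.1 hs
  have h0 := hv.zero (by omega)
  have hz : ((δ.update (B + 2) d).update (B + 3) e).val 0 = some (t L) := by
    simpa [DEnv.update] using h0
  rw [Formula.mem_sem_num ht hj hz] at h1 h2
  obtain ⟨a, -, haL, ha⟩ := h1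
  obtain ⟨b, -, hbL, hb⟩ := h2
  simp only [DEnv.update, Function.update_self, Function.update_of_ne (Nat.lt_succ_self _).ne,
    Option.some.injEq] at ha hb
  -- The equalities force the rebound `B` and `B + 1` to take the values of `B + 2` and `B + 3`, so
  -- requantifying acts as an assignment. The last conjunct gives `j < L`.
  simp only [BExp.eval_and, BExp.eval_eq, BExp.eval_ne, Exp.eval, Trace.drop_apply_zero] at hs
  obtain ⟨⟨⟨x, hx, hx'⟩, y, hy, hy'⟩, p, q, hp, hq, hpq⟩ := hs
  simp [DEnv.update, hB.ne, h0, ha, hb] at hx hx' hy hy' hp hq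
  subst hx hy hp hq hx' hy'
  have hjL : j ≠ L := fun h => hpq (congrArg t h)
  have ea : t a = t (L - (L - a)) := by rw [Nat.sub_sub_self haL]
  have eb : t b = t (L - (L - b)) := by rw [Nat.sub_sub_self hbL]
  rw [Trace.tail_drop] at hs'
  simp only [Formula.sem, Function.update_self, ha, hb, ea, eb] at hs' h3
  refine .step (L - a) (L - b) (hψ t L ht j hj _ _ _
    (hv.update_two (Nat.succ_pos _) (Nat.sub_le _ _) (Nat.sub_le _ _)) h3) ?_
  exact hs' (j + 1) (by omega) rfl _ ((((hv.mono (Nat.le_add_right B 2)).update_of_le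
    (Nat.le_add_right _ _) _).update_of_le (Nat.le_add_right _ _) _).update_two hB
      (Nat.sub_le _ _) (Nat.sub_le _ _))

theorem Complete.reaches {lo mid mid' : ℕ} {φ ψ : Formula} (hB : 0 < B)
    (hφ : Complete D (B + 2) φ R) (hψ : Complete D (B + 4) ψ T) :
    Complete D (B + 2) (Formula.reaches lo mid mid' B φ ψ) (Reaches B R T) := by
  suffices H : ∀ v, Reaches B R T v → ∃ N, ∀ (t : Trace D) (L : ℕ), InjOn t (Iic L) →
      ∀ j, j + N ≤ L → ∀ (ρ : TEnv D) (δ : DEnv D), Represents t L (B + 2) δ v →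
      t.drop j ∈ (Formula.reaches lo mid mid' B φ ψ).sem ρ δ from H
  simp only [Formula.reaches, Formula.mem_sem_min]
  intro v hv
  induction hv with
  | base h =>
    obtain ⟨N, hN⟩ := hφ _ h
    exact ⟨N, fun t L ht j hj ρ δ hr F hF => hF δ (.inl (hN t L ht j hj _ δ hr))⟩
  | @step v a b h h' ih =>
    obtain ⟨N, hN⟩ := hψ _ h
    obtain ⟨N', hN'⟩ := ih
    -- Reserve for the step relation, for the rest of the derivation, for reading `a` and `b`, and
    -- one letter for the modality guarding the recursion.
    refine ⟨N + N' + a + b + 1, fun t L ht j hj ρ δ hr F hF => hF δ (.inr ?_)⟩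
    have haL : a ≤ L := by omega
    have hbL : b ≤ L := by omega
    have hr4 := hr.update_two (Nat.succ_pos _) haL hbL
    have hr' := (((hr.mono (Nat.le_add_right B 2)).update_of_le
      (Nat.le_add_right B 2) (t (L - a))).update_of_le (Nat.le_add_right B 3)
        (t (L - b))).update_two hB haL hbL
    refine mem_iUnion.2 ⟨t (L - a), mem_iUnion.2 ⟨t (L - b), ?_, ?_, ?_, ?_⟩⟩
    · refine Formula.mem_sem_num_of_represents (B := B + 4) ht hr4 (Nat.lt_succ_self (B + 2) |>.trans (Nat.lt_succ_self _)) ?_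
      rw [Function.update_of_ne (Nat.lt_succ_self _).ne, Function.update_self]
      omega
    · refine Formula.mem_sem_num_of_represents ht hr4 (Nat.lt_succ_self _) ?_
      rw [Function.update_self]
      omega
    · exact hN t L ht j (by omega) _ _ hr4
    · refine mem_iUnion.2 ⟨t (L - a), mem_iUnion.2 ⟨t (L - b), ?_, ?_⟩⟩
      · have hne : t j ≠ t L := fun h => by
          have := ht (mem_Iic.2 (by omega)) (mem_Iic.2 le_rfl) h
          omega
        have h0 := hr.zero (Nat.succ_pos _)
        simp [BExp.eval_and, BExp.eval_eq, BExp.eval_ne, Exp.eval, Trace.drop_apply_zero,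
          DEnv.update, hB.ne, h0, hne]
      · rw [Trace.tail_drop]
        simp only [Formula.sem, Function.update_self]
        exact hN' t L ht (j + 1) (by omega) ρ _ hr' F hF

theorem Definable.reaches (hB : 0 < B) (hR : Definable D (B + 2) R)
    (hT : Definable D (B + 4) T) : Definable D (B + 2) (Reaches B R T) := by
  intro lo
  obtain ⟨mid, φ, hw, hs, hc⟩ := hR (lo + 1)
  obtain ⟨hi, ψ, hw', hs', hc'⟩ := hT (mid + 2)
  exact ⟨hi, _, hw.reaches hw', hs.reaches hB hs', hc.reaches hB hc'⟩

/-! ### Graphs of partial recursive functions are definable -/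

/-- The graph of `f` is definable, whatever the data variables for arguments and value. -/
def GraphDefinable (D : Type u) {n : ℕ} (f : List.Vector ℕ n →. ℕ) : Prop :=
  ∀ B, 0 < B → ∀ (r : Fin n → ℕ) (y : ℕ), (∀ i, r i < B) → y < B →
    Definable D B fun v => v y ∈ f (List.Vector.ofFn fun i => v (r i))

theorem mem_mOfFn {n : ℕ} (g : Fin n → Part ℕ) (w : List.Vector ℕ n) :
    w ∈ (List.Vector.mOfFn g : Part (List.Vector ℕ n)) ↔ ∀ i, w.get i ∈ g i := by
  induction n with
  | zero => simpa [List.Vector.mOfFn, pure] using Subsingleton.elim _ _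
  | succ n ih =>
    have h0 : w = w.head ::ᵥ w.tail := (w.cons_head_tail).symm
    simp only [List.Vector.mOfFn, Part.bind_eq_bind, Part.mem_bind_iff, Part.pure_eq_some,
      Part.mem_some_iff, ih, Fin.forall_fin_succ, List.Vector.get_zero]
    constructor
    · rintro ⟨a, ha, b, hb, rfl⟩
      simpa using ⟨ha, hb⟩
    · rintro ⟨ha, hb⟩
      exact ⟨w.head, ha, w.tail, fun i => by simpa using hb i, h0⟩

theorem exists_extend (B : ℕ) (v : ℕ → ℕ) (a b : ℕ) :
    ∃ w : ℕ → ℕ, (∀ x < B, w x = v x) ∧ w B = a ∧ w (B + 1) = b :=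
  ⟨Function.update (Function.update v B a) (B + 1) b, fun x hx => by
    rw [Function.update_of_ne (by omega), Function.update_of_ne (by omega)], by simp, by simp⟩

/-! ### Basic functions, composition, primitive recursion and minimisation. -/

namespace GraphDefinable

variable {D : Type u} {m n : ℕ}

theorem zero : GraphDefinable D (n := 0) ((fun _ => 0 : List.Vector ℕ 0 → ℕ) : List.Vector ℕ 0 →. ℕ) :=
  fun B hB r y _ hy => (Definable.eq hy hB).congr fun v h0 => by simp [h0]

theorem succ : GraphDefinable D (n := 1)
    ((fun v => v.head + 1 : List.Vector ℕ 1 → ℕ) : List.Vector ℕ 1 →. ℕ) :=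
  fun B hB r y hr hy => (Definable.succ hy (hr 0)).congr fun v h0 => by simp

theorem get (i : Fin n) :
    GraphDefinable D ((fun v => v.get i : List.Vector ℕ n → ℕ) : List.Vector ℕ n →. ℕ) :=
  fun B hB r y hr hy => (Definable.eq hy (hr i)).congr fun v h0 => by simp

/-- The values of the inner functions are stored in the fresh variables `B, …, B + n - 1`. -/
theorem comp {f : List.Vector ℕ n → Part ℕ} {g : Fin n → List.Vector ℕ m →. ℕ}
    (hf : GraphDefinable D f) (hg : ∀ i, GraphDefinable D (g i)) :
    GraphDefinable D fun v => (List.Vector.mOfFn fun i => g i v) >>= f := by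
  intro B hB r y hr hy
  have h1 := Definable.forall_fin n fun i => hg i (B + n) (by omega) r (B + i)
    (fun i => (hr i).trans_le (Nat.le_add_right _ _)) (by omega)
  have h2 := hf (B + n) (by omega) (fun i => B + i) y (fun i => by omega) (by omega)
  refine (Definable.exists_agree hB n (h1.and h2)).congr fun v _ => ?_
  simp only [Part.bind_eq_bind, Part.mem_bind_iff, mem_mOfFn]
  constructor
  · rintro ⟨w, hw, hy'⟩
    refine ⟨fun x => if h : B ≤ x ∧ x - B < n then w.get ⟨x - B, h.2⟩ else v x,
      fun x hx => dif_neg (by omega), ?_, ?_⟩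
    · intro i
      have : ∀ i, ¬ (B ≤ r i ∧ r i - B < n) := fun i => by have := hr i; omega
      simpa [this] using hw i
    · have : ¬ (B ≤ y ∧ y - B < n) := by omega
      simp only [this, dif_neg, not_false_eq_true]
      simpa using hy'
  · rintro ⟨w, hw, h, hy'⟩
    simp only [hw _ (hr _), hw _ hy] at h hy'
    exact ⟨_, fun i => by simpa using h i, hy'⟩

/-- The pair in `B`, `B + 1` is a counter and the value computed so far. It starts at `0` and `f us`
(`hinit`), moves by `hstep`, and `hbase` is the exit test: counter equal to the recursion argument
and value equal to `y`. -/
theorem prec {f : List.Vector ℕ n → ℕ} {g : List.Vector ℕ (n + 2) → ℕ}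
    (hf : GraphDefinable D (f : List.Vector ℕ n →. ℕ)) (hg : GraphDefinable D (g : List.Vector ℕ (n + 2) →. ℕ)) :
    GraphDefinable D ((fun v => v.head.rec (f v.tail) fun y IH => g (y ::ᵥ IH ::ᵥ v.tail) :
      List.Vector ℕ (n + 1) → ℕ) : List.Vector ℕ (n + 1) →. ℕ) := by
  intro B hB r y hr hy
  have hr' : ∀ k, ∀ i : Fin n, r i.succ < B + k := fun k i => (hr i.succ).trans_le (by omega)
  have hbase := (Definable.eq (D := D) (B := B + 2) (x := B) (y := r 0) (by omega)
    ((hr 0).trans (by omega))).and (Definable.eq (x := y) (y := B + 1) (by omega) (by omega))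
  have hstep := (Definable.succ (D := D) (B := B + 4) (x := B + 2) (y := B) (by omega)
    (by omega)).and (hg (B + 4) (by omega) (Fin.cons B (Fin.cons (B + 1) fun i => r i.succ)) (B + 3)
      (fun i => Fin.cases (by simp) (fun i => Fin.cases (by simp)
        (fun i => by simpa using hr' 4 i) i) i) (by omega))
  have hinit := (Definable.eq (D := D) (B := B + 2) (x := B) (y := 0) (by omega) (by omega)).and
    (hf (B + 2) (by omega) (fun i => r i.succ) (B + 1) (hr' 2) (by omega))
  refine (Definable.exists_agree hB 2 (hinit.and (Definable.reaches hB hbase hstep))).congr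
    fun v h0 => ?_
  set us : List.Vector ℕ n := List.Vector.ofFn fun i => v (r i.succ) with hus
  set P : ℕ → ℕ := fun k => k.rec (f us) fun y IH => g (y ::ᵥ IH ::ᵥ us) with hP
  have hP0 : P 0 = f us := rfl
  have hv : (v y ∈ ((fun v => v.head.rec (f v.tail) fun y IH => g (y ::ᵥ IH ::ᵥ v.tail) :
      List.Vector ℕ (n + 1) → ℕ) : List.Vector ℕ (n + 1) →. ℕ) (List.Vector.ofFn fun i => v (r i))) ↔
      v y = P (v (r 0)) := by
    simp [hP, hus, List.Vector.tail_ofFn]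
  rw [hv]
  have hcons : ∀ w : ℕ → ℕ, (List.Vector.ofFn fun i => w ((Fin.cons B (Fin.cons (B + 1)
      fun i => r i.succ) : Fin (n + 2) → ℕ) i)) =
      w B ::ᵥ w (B + 1) ::ᵥ List.Vector.ofFn fun i => w (r i.succ) := fun w => rfl
  simp only [PFun.coe_val, Part.mem_some_iff, hcons]
  have hagree : ∀ w : ℕ → ℕ, (∀ x < B, w x = v x) → ∀ k a, ∀ x < B,
      Function.update w (B + k) a x = v x := fun w hw k a x hx => by
    rw [Function.update_of_ne (by omega), hw x hx]
  have hargs : ∀ w : ℕ → ℕ, (∀ x < B, w x = v x) →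
      (List.Vector.ofFn fun i => w (r i.succ)) = us := fun w hw => by simp only [hw _ (hr _), us]
  constructor
  · intro hvy
    -- `d` is the number of iterations still to be done.
    have key : ∀ d w, (∀ x < B, w x = v x) → w B + d = v (r 0) → w (B + 1) = P (w B) →
        Reaches B (fun w => w B = w (r 0) ∧ w y = w (B + 1)) (fun w => w (B + 2) = w B + 1 ∧
          w (B + 3) = g (w B ::ᵥ w (B + 1) ::ᵥ List.Vector.ofFn fun i => w (r i.succ))) w := by
      intro d
      induction d with
      | zero =>
        intro w hw hd h1
        refine .base ⟨by rw [hw _ (hr 0)]; exact hd, ?_⟩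
        rw [hw y hy, hvy, h1, ← hd, Nat.add_zero]
      | succ d ih =>
        intro w hw hd h1
        refine .step (w B + 1) (P (w B + 1)) ⟨?_, ?_⟩ (ih _ (hagree _ (hagree w hw 0 _) 1 _) ?_ ?_)
        · simp
        · rw [hargs _ (hagree _ (hagree w hw 2 _) 3 _)]
          simp [h1, hP]
        · simp; omega
        · simp
    obtain ⟨w, hw, e0, e1⟩ := exists_extend B v 0 (f us)
    exact ⟨w, hw, ⟨by rw [e0, hw 0 hB, h0], by rw [e1, hargs w hw]⟩,
      key (v (r 0)) w hw (by rw [e0, Nat.zero_add]) (by rw [e1, e0, hP0])⟩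
  · rintro ⟨w, hw, ⟨hB0, hB1⟩, hreach⟩
    -- The loop invariant: it holds initially, each step preserves it, and at the exit it yields the
    -- value of `y`.
    have h1 : w (B + 1) = P (w B) := by
      rw [hB1, hargs w hw, hB0, hw 0 hB, h0, hP0]
    clear hB0 hB1
    induction hreach with
    | base h => rw [← hw y hy, h.2, h1, h.1, hw _ (hr 0)]
    | @step w a b h h' ih =>
      rw [hargs _ (hagree _ (hagree w hw 2 _) 3 _)] at h
      simp [h1] at h
      refine ih (hagree _ (hagree w hw 0 _) 1 _) ?_
      simp [h.1, h.2, hP]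

theorem rfind {f : List.Vector ℕ (n + 1) → ℕ}
    (hf : GraphDefinable D (f : List.Vector ℕ (n + 1) →. ℕ)) :
    GraphDefinable D fun v : List.Vector ℕ n =>
      Nat.rfind fun k => Part.some (f (k ::ᵥ v) = 0 : Bool) := by
  intro B hB r y hr hy
  have hr' : ∀ k, ∀ i : Fin n, r i < B + k := fun k i => (hr i).trans_le (by omega)
  have hf' := fun k (hk : 0 < k) y (hy : y < B + k) => hf (B + k) (by omega)
    (Fin.cons B r) y (fun i => Fin.cases (by simpa using hk) (fun i => by simpa using hr' k i) i) hy
  -- Variable `0` doubles as the constant zero in the test that `f` vanishes.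
  have hbase := (Definable.eq (D := D) (B := B + 2) (x := y) (y := B) (by omega)
    (by omega)).and (hf' 2 (by omega) 0 (by omega))
  -- The counter may advance only if `f` takes a nonzero value there, stated positively: the value
  -- is the successor of the number guessed in `B + 3`.
  have hstep := (Definable.succ (D := D) (B := B + 4) (x := B + 2) (y := B) (by omega)
    (by omega)).and (Definable.ex (B := B + 4) (by omega) ((hf' 5 (by omega) (B + 4) (by omega)).and
      (Definable.succ (B := B + 5) (x := B + 4) (y := B + 3) (by omega) (by omega))))
  have hinit := Definable.eq (D := D) (B := B + 2) (x := B) (y := 0) (by omega) (by omega)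
  refine (Definable.exists_agree hB 2 (hinit.and (Definable.reaches hB hbase hstep))).congr
    fun v h0 => ?_
  set us : List.Vector ℕ n := List.Vector.ofFn fun i => v (r i) with hus
  have hcons : ∀ w : ℕ → ℕ, (List.Vector.ofFn fun i => w ((Fin.cons B r : Fin (n + 1) → ℕ) i)) =
      w B ::ᵥ List.Vector.ofFn fun i => w (r i) := fun w => rfl
  simp only [PFun.coe_val, Part.mem_some_iff, hcons]
  have hagree : ∀ w : ℕ → ℕ, (∀ x < B, w x = v x) → ∀ k a, ∀ x < B,
      Function.update w (B + k) a x = v x := fun w hw k a x hx => by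
    rw [Function.update_of_ne (by omega), hw x hx]
  have hargs : ∀ w : ℕ → ℕ, (∀ x < B, w x = v x) →
      (List.Vector.ofFn fun i => w (r i)) = us := fun w hw => by simp only [hw _ (hr _), us]
  have hv : (v y ∈ Nat.rfind fun k => Part.some (f (k ::ᵥ us) = 0 : Bool)) ↔
      f (v y ::ᵥ us) = 0 ∧ ∀ k < v y, f (k ::ᵥ us) ≠ 0 := by
    refine Nat.mem_rfind.trans ?_
    simp
  change (v y ∈ Nat.rfind fun k => Part.some (f (k ::ᵥ us) = 0 : Bool)) ↔ _
  rw [hv]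
  constructor
  · rintro ⟨hvy, hlt⟩
    have key : ∀ d w, (∀ x < B, w x = v x) → w B + d = v y →
        Reaches B (fun w => w y = w B ∧ w 0 = f (w B ::ᵥ List.Vector.ofFn fun i => w (r i)))
          (fun w => w (B + 2) = w B + 1 ∧ ∃ k, Function.update w (B + 4) k (B + 4) =
            f (Function.update w (B + 4) k B ::ᵥ List.Vector.ofFn fun i =>
              Function.update w (B + 4) k (r i)) ∧ Function.update w (B + 4) k (B + 4) =
                Function.update w (B + 4) k (B + 3) + 1) w := by
      intro d
      induction d with
      | zero =>
        intro w hw hd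
        rw [Nat.add_zero] at hd
        exact .base ⟨by rw [hw y hy, hd], by rw [hw 0 hB, h0, hargs w hw, hd, hvy]⟩
      | succ d ih =>
        intro w hw hd
        have hpos := hlt (w B) (by omega)
        -- The second component is the predecessor required by the step; truncated subtraction is
        -- exact because `hpos` makes the value nonzero.
        refine .step (w B + 1) (f (w B ::ᵥ us) - 1) ⟨by simp, f (w B ::ᵥ us), ?_, ?_⟩
          (ih _ (hagree _ (hagree w hw 0 _) 1 _) ?_)
        · rw [hargs _ (hagree _ (hagree _ (hagree w hw 2 _) 3 _) 4 _)]
          simp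
        · simp; omega
        · simp; omega
    obtain ⟨w, hw, e0, -⟩ := exists_extend B v 0 0
    exact ⟨w, hw, by rw [e0, hw 0 hB, h0], key (v y) w hw (by rw [e0, Nat.zero_add])⟩
  · rintro ⟨w, hw, hB0, hreach⟩
    have h1 : ∀ k < w B, f (k ::ᵥ us) ≠ 0 := by
      rw [hB0, hw 0 hB, h0]
      exact fun k hk => absurd hk (Nat.not_lt_zero k)
    clear hB0
    induction hreach with
    | base h =>
      rw [← hw y hy, h.1]
      refine ⟨?_, h1⟩
      rw [← hargs _ hw, ← h.2, hw 0 hB, h0]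
    | @step w a b h h' ih =>
      obtain ⟨h2, k, h3, h4⟩ := h
      rw [hargs _ (hagree _ (hagree _ (hagree w hw 2 _) 3 _) 4 _)] at h3
      simp at h2 h3 h4
      refine ih (hagree _ (hagree w hw 0 _) 1 _) ?_
      simp only [Function.update_of_ne (Nat.lt_succ_self B).ne, Function.update_self, h2]
      intro m hm
      rcases Nat.lt_succ_iff_lt_or_eq.1 hm with hm | rfl
      · exact h1 m hm
      · omega

theorem of_primrec {f : List.Vector ℕ n → ℕ} (hf : Nat.Primrec' f) :
    GraphDefinable D (f : List.Vector ℕ n →. ℕ) := by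
  induction hf with
  | zero => exact zero
  | succ => exact succ
  | get i => exact get i
  | comp g _ _ hf hg =>
    refine (congrArg (GraphDefinable D) (funext fun v => ?_)).mpr (comp hf hg)
    simp only [PFun.coe_val, Vector.mOfFn_part_some]
    exact (Part.bind_some _ _).symm
  | prec _ _ hf hg => exact prec hf hg

theorem of_partrec {f : List.Vector ℕ n →. ℕ} (hf : Nat.Partrec' f) : GraphDefinable D f := by
  induction hf with
  | prim hf => exact of_primrec hf
  | comp g _ _ hf hg => exact comp hf hg
  | rfind _ hf => exact rfind hf

end GraphDefinable

/-- The domain of a partial recursive function is definable. -/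
theorem Definable.dom {D : Type u} {f : ℕ →. ℕ} (hf : Partrec f) :
    Definable D 2 fun v => (f (v 1)).Dom := by
  have h := GraphDefinable.of_partrec (D := D) (Nat.Partrec'.part_iff₁.2 hf)
  refine ((h 3 (by omega) (fun _ => 1) 2 (fun _ => by omega) (by omega)).ex
    (by omega)).congr fun v _ => ?_
  simp [Part.dom_iff_mem]

/-! ### The reduction -/

namespace Formula

/-- The value of `0` occurs, and the value of `1` does not occur before. -/
def avoids (X : FVar) : Formula :=
  .min X (.or (.pos (.eq .star (.var 0)) .tt)
    (.pos (.and (.ne .star (.var 0)) (.ne .star (.var 1))) (.var X)))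

/-- The value of `0` occurs, and the letters up to its first occurrence are distinct. -/
def distinct (X Y : FVar) : Formula :=
  .min X (.or (.pos (.eq .star (.var 0)) .tt)
    (.and (.pos (.ne .star (.var 0)) (.var X)) (.ex 1 (.pos (.eq .star (.var 1)) (avoids Y)))))

/-- The first occurrence of the value of `0` is at position `k`. -/
def zeroAt (k : ℕ) : Formula :=
  k.rec (.pos (.eq .star (.var 0)) .tt) fun _ φ => .pos (.ne .star (.var 0)) φ

/-- The value of `1` represents the number `k`. -/
def numeral (X : FVar) (k : ℕ) : Formula :=
  (Formula.and (.pos (.eq .star (.var 1)) .tt) (zeroAt k)).eventually X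

/-- Some trace represents numbers on which `φ` holds when `1` represents `k`. -/
def instanceOf (φ : Formula) (k : ℕ) : Formula :=
  .ex 0 (.and (distinct 0 1) (.ex 1 (.and (numeral 2 k) φ)))

end Formula

namespace WF

variable {S : Set FVar}

theorem star_eq {B x : ℕ} (hx : x < B) : ∀ y ∈ (BExp.eq .star (.var x)).dvars, y < B := by
  simpa [BExp.dvars, Exp.dvars] using hx

theorem star_ne {B x : ℕ} (hx : x < B) : ∀ y ∈ (BExp.ne .star (.var x)).dvars, y < B :=
  star_eq hx

theorem avoids {X : ℕ} : WF 2 S X (X + 1) (Formula.avoids X) :=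
  ((tt.pos (star_eq two_pos)).or (pos_var (by simp [BExp.dvars, Exp.dvars])
    (mem_insert _ _))).min

theorem distinct {X : ℕ} : WF 1 S X (X + 2) (Formula.distinct X (X + 1)) :=
  ((tt.pos (star_eq one_pos)).or ((pos_var (star_ne one_pos) (mem_insert _ _)).and
    (ex_last (avoids.pos (star_eq one_lt_two))))).min

theorem zeroAt {X : ℕ} (k : ℕ) : WF 1 S X X (Formula.zeroAt k) := by
  induction k with
  | zero => exact tt.pos (star_eq one_pos)
  | succ k ih => exact ih.pos (star_ne one_pos)

theorem numeral {X : ℕ} (k : ℕ) : WF 2 S X (X + 1) (Formula.numeral X k) :=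
  ((tt.pos (star_eq one_lt_two)).and
    ((zeroAt k).mono one_le_two le_rfl le_rfl le_rfl)).eventually two_pos

theorem instanceOf {hi : ℕ} {φ : Formula} (h : WF 2 ∅ 3 hi φ) (k : ℕ) :
    WF 0 ∅ 0 hi (φ.instanceOf k) :=
  ex_last (distinct.and (ex_last ((numeral k).and h)))

end WF

/-! ### Semantics of the reduction formulae. -/

variable {D : Type u}

theorem Formula.exists_of_mem_sem_avoids {X : FVar} {ρ : TEnv D} {δ : DEnv D} {s : Trace D}
    {z x : D} (hz : δ.val 0 = some z) (hx : δ.val 1 = some x)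
    (h : s ∈ (Formula.avoids X).sem ρ δ) : ∃ L, s L = z ∧ ∀ i < L, s i ≠ z ∧ s i ≠ x := by
  rw [Formula.avoids, Formula.mem_sem_min] at h
  refine h (fun δ => {s | δ.val 0 = some z → δ.val 1 = some x →
    ∃ L, s L = z ∧ ∀ i < L, s i ≠ z ∧ s i ≠ x}) ?_ hz hx
  rintro δ s hs hz hx
  rcases hs with ⟨hs, -⟩ | ⟨hs, hs'⟩
  · simp only [BExp.eval_eq, Exp.eval, hz, Option.some.injEq, exists_eq_left'] at hs
    exact ⟨0, hs.symm, by simp⟩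
  · simp only [Formula.sem, Function.update_self] at hs'
    obtain ⟨L, hL, h⟩ := hs' hz hx
    simp [BExp.eval_and, BExp.eval_ne, Exp.eval, hz, hx] at hs
    refine ⟨L + 1, hL, fun i hi => ?_⟩
    cases i with
    | zero => exact hs
    | succ i => exact h i (by omega)

theorem Formula.exists_of_mem_sem_distinct {X Y : FVar} {ρ : TEnv D} {δ : DEnv D} {s : Trace D}
    {z : D} (hz : δ.val 0 = some z) (h : s ∈ (Formula.distinct X Y).sem ρ δ) :
    ∃ L, s L = z ∧ InjOn s (Iic L) := by
  rw [Formula.distinct, Formula.mem_sem_min] at h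
  refine h (fun δ => {s | δ.val 0 = some z → ∃ L, s L = z ∧ InjOn s (Iic L)}) ?_ hz
  rintro δ s hs hz
  rcases hs with ⟨hs, -⟩ | ⟨⟨hs, hs'⟩, h⟩
  · simp only [BExp.eval_eq, Exp.eval, hz, Option.some.injEq, exists_eq_left'] at hs
    refine ⟨0, hs.symm, fun i hi k hk _ => ?_⟩
    rw [Nat.le_zero.1 hi, Nat.le_zero.1 hk]
  · simp only [Formula.sem, Function.update_self] at hs'
    obtain ⟨L, hL, hinj⟩ := hs' hz
    obtain ⟨d, h1, h2⟩ := mem_iUnion.1 h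
    simp [BExp.eval_eq, Exp.eval, DEnv.update_same] at h1
    subst h1
    obtain ⟨L', hL', h'⟩ := Formula.exists_of_mem_sem_avoids
      (by rw [DEnv.update_of_ne _ (by decide), hz]) (DEnv.update_same _ _ _) h2
    simp [BExp.eval_ne, Exp.eval, hz] at hs
    -- Both fixed points stop at the first occurrence of `z` in the tail: `avoids` sees no earlier
    -- `z`, and injectivity excludes a second one before `L`.
    have hle : L' ≤ L := not_lt.1 fun hlt => (h' L hlt).1 hL
    have hLL : L' = L := hinj hle (mem_Iic.2 le_rfl) (hL'.trans hL.symm)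
    subst hLL
    -- `avoids` does not compare the final letter with `s 0`; that case follows from the guard `s 0
    -- ≠ z`.
    have hne : ∀ i ≤ L', s (i + 1) ≠ s 0 := fun i hi => by
      rcases hi.lt_or_eq with hi | rfl
      · exact (h' i hi).2
      · exact fun h => hs (h.symm.trans hL)
    refine ⟨L' + 1, hL, fun i hi k hk hik => ?_⟩
    rw [mem_Iic] at hi hk
    match i, k with
    | 0, 0 => rfl
    | 0, k + 1 => exact absurd hik.symm (hne k (by omega))
    | i + 1, 0 => exact absurd hik (hne i (by omega))
    | i + 1, k + 1 =>
      rw [hinj (mem_Iic.2 (by omega : i ≤ L')) (mem_Iic.2 (by omega : k ≤ L')) hik]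

theorem Formula.mem_sem_avoids {X : FVar} {ρ : TEnv D} {δ : DEnv D} {t : Trace D} {L i j : ℕ}
    (ht : InjOn t (Iic L)) (hz : δ.val 0 = some (t L)) (hx : δ.val 1 = some (t i)) (hij : i < j)
    (hj : j ≤ L) : t.drop j ∈ (Formula.avoids X).sem ρ δ := by
  rw [Formula.avoids, Formula.mem_sem_min]
  intro F hF
  induction hj using Nat.decreasingInduction with
  | self => exact hF δ (.inl ⟨by simp [BExp.eval_eq, Exp.eval, hz, Trace.drop_apply_zero], trivial⟩)
  | of_succ k hk ih =>
    refine hF δ (.inr ⟨?_, ?_⟩)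
    · have h1 : t k ≠ t L := fun h => hk.ne (ht (mem_Iic.2 hk.le) (mem_Iic.2 le_rfl) h)
      have h2 : t k ≠ t i := fun h =>
        hij.ne' (ht (mem_Iic.2 hk.le) (mem_Iic.2 (hij.le.trans hk.le)) h)
      simp [BExp.eval_and, BExp.eval_ne, Exp.eval, hz, hx, Trace.drop_apply_zero, h1, h2]
    · rw [Trace.tail_drop]
      simpa only [Formula.sem, Function.update_self] using ih (by omega)

theorem Formula.mem_sem_distinct {X Y : FVar} {ρ : TEnv D} {δ : DEnv D} {t : Trace D} {L j : ℕ}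
    (ht : InjOn t (Iic L)) (hz : δ.val 0 = some (t L)) (hj : j ≤ L) :
    t.drop j ∈ (Formula.distinct X Y).sem ρ δ := by
  rw [Formula.distinct, Formula.mem_sem_min]
  intro F hF
  induction hj using Nat.decreasingInduction with
  | self => exact hF δ (.inl ⟨by simp [BExp.eval_eq, Exp.eval, hz, Trace.drop_apply_zero], trivial⟩)
  | of_succ k hk ih =>
    refine hF δ (.inr ⟨⟨?_, ?_⟩, mem_iUnion.2 ⟨t k, ?_, ?_⟩⟩)
    · have h1 : t k ≠ t L := fun h => hk.ne (ht (mem_Iic.2 hk.le) (mem_Iic.2 le_rfl) h)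
      simp [BExp.eval_ne, Exp.eval, hz, Trace.drop_apply_zero, h1]
    · rw [Trace.tail_drop]
      simpa only [Formula.sem, Function.update_self] using ih
    · simp [BExp.eval_eq, Exp.eval, DEnv.update_same, Trace.drop_apply_zero]
    · rw [Trace.tail_drop]
      exact Formula.mem_sem_avoids ht (by rw [DEnv.update_of_ne _ (by decide), hz])
        (DEnv.update_same _ _ _) (Nat.lt_succ_self k) hk

theorem Formula.mem_sem_zeroAt {k : ℕ} {ρ : TEnv D} {δ : DEnv D} {s : Trace D} {z : D}
    (hz : δ.val 0 = some z) :
    s ∈ (Formula.zeroAt k).sem ρ δ ↔ s k = z ∧ ∀ i < k, s i ≠ z := by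
  induction k generalizing s with
  | zero =>
    simp [Formula.zeroAt, Formula.sem, BExp.eval_eq, Exp.eval, hz]
    exact eq_comm
  | succ k ih =>
    change _ ∧ s.tail ∈ (Formula.zeroAt k).sem ρ δ ↔ _
    rw [ih, Nat.forall_lt_succ_left]
    simp [BExp.eval_ne, Exp.eval, hz, Trace.tail]
    tauto

/-- Position `L` carries the only occurrence of the value of `0` among the first `L + 1` letters, so
a suffix that meets it first after `k` letters starts at `L - k`. -/
theorem Formula.mem_sem_numeral {X : FVar} {k : ℕ} {t : Trace D} {L : ℕ}
    (ht : InjOn t (Iic L)) {ρ : TEnv D} {δ : DEnv D} (hz : δ.val 0 = some (t L)) {d : D}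
    (hd : δ.val 1 = some d) :
    t ∈ (Formula.numeral X k).sem ρ δ ↔ k ≤ L ∧ d = t (L - k) := by
  have h := Formula.mem_sem_eventually (X := X) ht (Nat.zero_le L) (ρ := ρ) hz
    (φ := Formula.and (.pos (.eq .star (.var 1)) .tt) (zeroAt k))
    (P := fun s => s 0 = d ∧ s k = t L ∧ ∀ i < k, s i ≠ t L) (fun ρ s => by
      simp only [Formula.sem, mem_inter_iff, Formula.mem_sem_zeroAt hz]
      simp [BExp.eval_eq, Exp.eval, hd, eq_comm (a := d)])
  rw [Trace.drop_zero] at h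
  rw [Formula.numeral, h]
  constructor
  · rintro ⟨i, -, hi, h1, h2, h3⟩
    have hik : i + k ≤ L := not_lt.1 fun hlt => h3 (L - i) (by omega) (by
      change t (i + (L - i)) = t L
      rw [Nat.add_sub_cancel' hi])
    have : i + k = L := ht (mem_Iic.2 hik) (mem_Iic.2 le_rfl) h2
    exact ⟨by omega, by rw [← h1, ← this, Nat.add_sub_cancel]; rfl⟩
  · rintro ⟨hk, rfl⟩
    refine ⟨L - k, Nat.zero_le _, Nat.sub_le _ _, rfl, ?_, fun i hi h => ?_⟩
    · change t (L - k + k) = t L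
      rw [Nat.sub_add_cancel hk]
    · have := ht (mem_Iic.2 (by omega : L - k + i ≤ L)) (mem_Iic.2 le_rfl) h
      omega

theorem Formula.satisfiable_instanceOf_iff [Infinite D] {φ : Formula} {p : ℕ → Prop}
    (hs : Sound D 2 φ fun v => p (v 1)) (hc : Complete D 2 φ fun v => p (v 1)) (k : ℕ) :
    (φ.instanceOf k).Satisfiable D ↔ p k := by
  have hrep : ∀ (t : Trace D) (L : ℕ), k ≤ L → Represents t L 2
      (((DEnv.empty D).update 0 (t L)).update 1 (t (L - k))) fun x => if x = 1 then k else 0 := by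
    refine fun t L hk => ⟨rfl, fun x hx => ?_⟩
    have : x = 0 ∨ x = 1 := by omega
    rcases this with rfl | rfl
    · simp [DEnv.update]
    · simpa [DEnv.update] using hk
  constructor
  · rintro ⟨t, ht⟩
    obtain ⟨z, h1, ht⟩ := mem_iUnion.1 ht
    obtain ⟨d, h2, h3⟩ := mem_iUnion.1 ht
    obtain ⟨L, rfl, hinj⟩ := Formula.exists_of_mem_sem_distinct (DEnv.update_same _ _ _) h1
    obtain ⟨hk, rfl⟩ := (Formula.mem_sem_numeral hinj
      (by rw [DEnv.update_of_ne _ (by decide), DEnv.update_same]) (DEnv.update_same _ _ _)).1 h2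
    simpa using hs t L hinj 0 (Nat.zero_le _) (fun _ _ => ∅) _ _ (hrep t L hk)
      (by rw [Trace.drop_zero]; exact h3)
  · intro hp
    obtain ⟨N, hN⟩ := hc (fun x => if x = 1 then k else 0) (by simpa using hp)
    -- Any injective trace works once `L = N + k` leaves room both for the numeral and for the
    -- reserve `N`.
    let t : Trace D := Infinite.natEmbedding D
    have ht : InjOn t (Iic (N + k)) := (Infinite.natEmbedding D).injective.injOn
    refine ⟨t, mem_iUnion.2 ⟨t (N + k), ?_, mem_iUnion.2 ⟨t (N + k - k), ?_, ?_⟩⟩⟩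
    · simpa only [Trace.drop_zero] using
        Formula.mem_sem_distinct ht (DEnv.update_same _ _ _) (Nat.zero_le _)
    · exact (Formula.mem_sem_numeral ht (by rw [DEnv.update_of_ne _ (by decide), DEnv.update_same])
        (DEnv.update_same _ _ _)).2 ⟨Nat.le_add_left _ _, rfl⟩
    · simpa only [Trace.drop_zero] using
        hN t (N + k) ht 0 (by omega) _ _ (hrep t (N + k) (Nat.le_add_left _ _))

/-! ### Computability of the reduction -/

theorem Formula.primrec_toNat : Primrec Formula.toNat := Primrec.encode

theorem Formula.primrec_of_toNat {α : Type*} [Primcodable α] {f : α → Formula}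
    (h : Primrec fun a => (f a).toNat) : Primrec f := Primrec.encode_iff.1 h

/-- The shape of the code of every compound formula; `r` identifies the constructor. -/
theorem Formula.primrec_tag {α : Type*} [Primcodable α] {f g : α → ℕ} (hf : Primrec f)
    (hg : Primrec g) (r : ℕ) : Primrec fun a => 9 * Nat.pair (f a) (g a) + r :=
  Primrec.nat_add.comp (Primrec.nat_mul.comp (.const 9) (Primrec₂.natPair.comp hf hg)) (.const r)

section

variable {α : Type*} [Primcodable α] {f g : α → Formula}

theorem Formula.primrec_pos (b : BExp) (hf : Primrec f) : Primrec fun a => Formula.pos b (f a) :=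
  primrec_of_toNat (primrec_tag (.const _) (primrec_toNat.comp hf) 2)

theorem Formula.primrec_ex (x : DVar) (hf : Primrec f) : Primrec fun a => Formula.ex x (f a) :=
  primrec_of_toNat (primrec_tag (.const _) (primrec_toNat.comp hf) 4)

theorem Formula.primrec_or (hf : Primrec f) (hg : Primrec g) :
    Primrec fun a => Formula.or (f a) (g a) :=
  primrec_of_toNat (primrec_tag (primrec_toNat.comp hf) (primrec_toNat.comp hg) 6)

theorem Formula.primrec_and (hf : Primrec f) (hg : Primrec g) :
    Primrec fun a => Formula.and (f a) (g a) :=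
  primrec_of_toNat (primrec_tag (primrec_toNat.comp hf) (primrec_toNat.comp hg) 7)

theorem Formula.primrec_min (X : FVar) (hf : Primrec f) :
    Primrec fun a => Formula.min X (f a) :=
  primrec_of_toNat (primrec_tag (.const _) (primrec_toNat.comp hf) 8)

end

theorem Formula.primrec_zeroAt : Primrec Formula.zeroAt :=
  Primrec.nat_rec₁ _ (Formula.primrec_pos _ Primrec.snd)

theorem Formula.primrec_instanceOf (φ : Formula) : Primrec φ.instanceOf :=
  primrec_ex _ <| primrec_and (.const _) <| primrec_ex _ <| primrec_and
    (primrec_min _ <| primrec_or (primrec_and (.const _) primrec_zeroAt) (.const _)) (.const _)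

/-- Halting is many-one reducible to satisfiability. -/
theorem exists_reduction (D : Type u) [Infinite D] :
    ∃ f : Nat.Partrec.Code × ℕ → Formula, Computable f ∧
      ∀ (c : Nat.Partrec.Code) (n : ℕ), (f (c, n)).IsInstance ∧
        ((c.eval n).Dom ↔ (f (c, n)).Satisfiable D) := by
  have hpart : Partrec fun k : ℕ =>
      (Denumerable.ofNat (Nat.Partrec.Code × ℕ) k).1.eval
        (Denumerable.ofNat (Nat.Partrec.Code × ℕ) k).2 :=
    Nat.Partrec.Code.eval_part.comp (Computable.fst.comp (Computable.ofNat _))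
      (Computable.snd.comp (Computable.ofNat _))
  -- Recursion variables `0`, `1` and `2` are taken by `distinct` and `numeral`, so the bound ones
  -- of `φ` start at `3`.
  obtain ⟨hi, φ, hw, hs, hc⟩ := Definable.dom (D := D) hpart 3
  refine ⟨fun a => φ.instanceOf (Encodable.encode a),
    (Formula.primrec_instanceOf φ).to_comp.comp Computable.encode, fun c n =>
      ⟨(hw.instanceOf _).isInstance, ?_⟩⟩
  rw [Formula.satisfiable_instanceOf_iff (p := fun k =>
    ((Denumerable.ofNat (Nat.Partrec.Code × ℕ) k).1.eval
      (Denumerable.ofNat (Nat.Partrec.Code × ℕ) k).2).Dom) hs hc, Denumerable.ofNat_encode]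

end RecHML

/-- Over every countably infinite data domain, the halting problem reduces computably to the
satisfiability problem of the fragment, and no computable function decides the latter. -/
theorem mainTheorem9 (D : Type*) [Countable D] [Infinite D] :
    (∃ f : Nat.Partrec.Code × ℕ → RecHML.Formula, Computable f ∧
      ∀ (c : Nat.Partrec.Code) (n : ℕ), (f (c, n)).IsInstance ∧
        ((c.eval n).Dom ↔ (f (c, n)).Satisfiable D)) ∧
    ¬ ∃ g : RecHML.Formula → Bool, Computable g ∧
      ∀ φ : RecHML.Formula, φ.IsInstance → (g φ = true ↔ φ.Satisfiable D) := by
  obtain ⟨f, hf, h⟩ := RecHML.exists_reduction D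
  refine ⟨⟨f, hf, h⟩, ?_⟩
  rintro ⟨g, hg, hgs⟩
  -- Composing a decider with the reduction at the fixed input `0` would decide halting on input
  -- `0`.
  refine ComputablePred.halting_problem 0 (ComputablePred.computable_iff.2
    ⟨fun c => g (f (c, 0)), hg.comp (hf.comp (Computable.pair .id (.const 0))), ?_⟩)
  funext c
  exact propext ((h c 0).2.trans (hgs _ (h c 0).1).symm)
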